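/- **Setting.** A separable Banach space $(B,\|\cdot\|)$ is $(2,D)$-smooth if (i) there is an equivalent norm $N$ with $\sup_{t>0}t^{-2}\sup\{N(x+ty)+N(x-ty)-2 : N(x)=N(y)=1\}<\infty$, and (ii) $\mathbb E\|\sum_{i=1}^n X_i\|^2\le D\sum_{i=1}^n\mathbb E\|X_i\|^2$ for every $n$ and every $B$-valued martingale difference sequence $(X_i,\mathcal F_i)_{i\ge1}$ (that is: $(\mathcal F_i)$ is non-decreasing, $X_i$ is $\mathcal F_i$-measurable and integrable for $i\ge 1$, and $\mathbb E[X_i\mid\mathcal F_{i-1}]=0$ for $i\ge2$). A strictly stationary martingale difference sequence $(m\circ T^i,T^{-i}\mathcal F_0)_{i\ge 0}$ consists of a bijective, bi-measurable, measure preserving map $T$ of a probability space $(\Omega,\mathcal F,\mathbb P)$, a sub-$\sigma$-algebra $\mathcal F_0$ of $\mathcal F$ with $T\mathcal F_0\subset\mathcal F_0$, and a function $m:\Omega\to B$ such that $(m\circ T^i)_{i\ge0}$ is a martingale difference sequence for $(T^{-i}\mathcal F_0)_{i\ge0}$. Put $S_i(m)=\sum_{j=0}^{i-1}m\circ T^j$,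 $V=\mathbb E[\|m\|^2\mid T\mathcal F_0]$ and $a_n(x)=\mathbb P\{\max_{1\le i\le 2^n}\|S_i(m)\|>2^nx\}$. A random variable $Y$ belongs to $\mathbb L^{p,\infty}$ if $\sup_{t>0}t^p\mathbb P\{\|Y\|>t\}<\infty$, and to $\mathbb L^{p,\infty}_0$ if $t^p\mathbb P\{\|Y\|>t\}\to0$ as $t\to\infty$. **Theorem.** Let $s>2$ and let $B$ be a separable $(2,D)$-smooth Banach space. There is a constant $C=C(s,B)$ such that for every $B$-valued strictly stationary martingale difference sequence $(m\circ T^i,T^{-i}\mathcal F_0)$ the following holds. 1. If $m\in\mathbb L^{s/2+1,\infty}$ and $V\in\mathbb L^{s/2,\infty}$, then for each $x>0$ $$\sup_{n\ge1}2^{ns/2}a_n(x)\le C\Big(x^{-s/2-1}\sup_{t>0}t^{s/2+1}\mathbb P\{\|m\|>t\}+x^{-s}\sup_{t>0}t^{s/2}\mathbb P\{V>t\}\Big).$$ 2. If $m\in\mathbb L^{s/2+1,\infty}_0$ and $V\in\mathbb L^{s/2,\infty}_0$, then $\lim_{n\to\infty}2^{ns/2}a_n(x)=0$ for each $x>0$.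 3. If $m\in\mathbb L^{s/2+1}$ and $V\in\mathbb L^{s/2}$, then for each $x>0$ $$\sum_{n=1}^{\infty}2^{ns/2}a_n(x)\le C\Big(x^{-s/2-1}\,\mathbb E\|m\|^{s/2+1}+x^{-s}\,\mathbb E\,V^{s/2}\Big).$$ -/

import Mathlib

open MeasureTheory Filter Topology
open scoped NNReal ENNReal

universe u v

/-- `(X i, 𝓕 i)`, `i ∈ ℕ`, is a martingale difference sequence under `μ` (the first term is only
required to be adapted and integrable). For a separable `B`, strong measurability is Borel
measurability. -/
structure IsMartingaleDifference {Ω : Type u} {B : Type v} [NormedAddCommGroup B]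
    [NormedSpace ℝ B] [CompleteSpace B] (𝓕 : ℕ → MeasurableSpace Ω) [mΩ : MeasurableSpace Ω]
    (X : ℕ → Ω → B) (μ : Measure Ω) : Prop where
  mono : Monotone 𝓕
  le : ∀ i, 𝓕 i ≤ mΩ
  adapted : ∀ i, StronglyMeasurable[𝓕 i] (X i)
  integrable : ∀ i, Integrable (X i) μ
  condExp_eq_zero : ∀ i, μ[X (i + 1) | 𝓕 i] =ᵐ[μ] 0

/-- `B` is `r`-smooth: some equivalent norm `N` satisfies
`sup_{t > 0} t⁻ʳ sup {N (x + t y) + N (x - t y) - 2 : N x = N y = 1} < ∞`. -/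
def IsRSmooth (B : Type v) [NormedAddCommGroup B] [NormedSpace ℝ B] (r : ℝ) : Prop :=
  ∃ N : Seminorm ℝ B,
    (∃ a b : ℝ, 0 < a ∧ 0 < b ∧ ∀ x, a * ‖x‖ ≤ N x ∧ N x ≤ b * ‖x‖) ∧
    ∃ K : ℝ, ∀ t : ℝ, 0 < t → ∀ x y : B, N x = 1 → N y = 1 →
      N (x + t • y) + N (x - t • y) - 2 ≤ K * t ^ r

/-- `B` is `(r, D)`-smooth: it is `r`-smooth with `1 < r ≤ 2`, and
`E ‖X₁ + ⋯ + Xₙ‖ʳ ≤ D ∑ E ‖Xᵢ‖ʳ` for all `B`-valued martingale difference sequences, on any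
probability space. -/
structure IsRDSmooth (B : Type v) [NormedAddCommGroup B] [NormedSpace ℝ B] [CompleteSpace B]
    (r : ℝ) (D : ℝ≥0) : Prop where
  one_lt : 1 < r
  le_two : r ≤ 2
  smooth : IsRSmooth B r
  moment_le : ∀ (Ω : Type u) (𝓕 : ℕ → MeasurableSpace Ω) [MeasurableSpace Ω]
    (μ : Measure Ω) [IsProbabilityMeasure μ] (X : ℕ → Ω → B),
    IsMartingaleDifference 𝓕 X μ → ∀ n : ℕ,
      ∫⁻ ω, ‖∑ i ∈ Finset.range n, X i ω‖ₑ ^ r ∂μ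
        ≤ D * ∑ i ∈ Finset.range n, ∫⁻ ω, ‖X i ω‖ₑ ^ r ∂μ

/-- The `σ`-algebra `T 𝓖 = {T A : A ∈ 𝓖}`, for a bijection `T`. -/
abbrev imageSigma {Ω : Type u} (𝓖 : MeasurableSpace Ω) (T : Ω ≃ Ω) : MeasurableSpace Ω :=
  𝓖.comap T.symm

/-- `(m ∘ T ^ i, T ^ (-i) 𝓕₀)`, `i ≥ 0`, is a strictly stationary martingale difference
sequence: `T` is a bijective bi-measurable measure preserving map and `T 𝓕₀ ⊆ 𝓕₀`. -/
structure IsStationaryMartingaleDifference {Ω : Type u} {B : Type v} [NormedAddCommGroup B]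
    [NormedSpace ℝ B] [CompleteSpace B] (𝓕₀ : MeasurableSpace Ω) [mΩ : MeasurableSpace Ω]
    (T : Ω ≃ᵐ Ω) (m : Ω → B) (μ : Measure Ω) : Prop where
  measurePreserving : MeasurePreserving T μ μ
  image_le : imageSigma 𝓕₀ T.toEquiv ≤ 𝓕₀
  martingaleDifference :
    IsMartingaleDifference (fun i => 𝓕₀.comap (T^[i])) (fun i => m ∘ T^[i]) μ

/-- `E[‖m‖² | T 𝓕₀]`. -/
noncomputable def condSq {Ω : Type u} {B : Type v} [NormedAddCommGroup B]
    (𝓕₀ : MeasurableSpace Ω) [MeasurableSpace Ω] (T : Ω ≃ᵐ Ω) (m : Ω → B)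
    (μ : Measure Ω) : Ω → ℝ :=
  μ[fun ω => ‖m ω‖ ^ 2 | imageSigma 𝓕₀ T.toEquiv]

/-- `t ^ p * P (‖Y‖ > t)`. -/
noncomputable def scaledTail {Ω : Type u} {E : Type v} [NormedAddCommGroup E]
    [MeasurableSpace Ω] (p : ℝ) (Y : Ω → E) (μ : Measure Ω) (t : ℝ) : ℝ≥0∞ :=
  ENNReal.ofReal (t ^ p) * μ {ω | t < ‖Y ω‖}

/-- `sup_{t > 0} t ^ p * P (‖Y‖ > t)`. -/
noncomputable def weakMoment {Ω : Type u} {E : Type v} [NormedAddCommGroup E]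
    [MeasurableSpace Ω] (p : ℝ) (Y : Ω → E) (μ : Measure Ω) : ℝ≥0∞ :=
  ⨆ (t : ℝ) (_ : 0 < t), scaledTail p Y μ t

/-- `Y ∈ L^{p,∞}`. -/
def MemWeakLp {Ω : Type u} {E : Type v} [NormedAddCommGroup E] [MeasurableSpace Ω]
    (p : ℝ) (Y : Ω → E) (μ : Measure Ω) : Prop :=
  AEStronglyMeasurable Y μ ∧ weakMoment p Y μ < ∞

/-- `Y ∈ L₀^{p,∞}`: `t ^ p * P (‖Y‖ > t) → 0` as `t → ∞`. -/
def MemWeakLpZero {Ω : Type u} {E : Type v} [NormedAddCommGroup E] [MeasurableSpace Ω]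
    (p : ℝ) (Y : Ω → E) (μ : Measure Ω) : Prop :=
  AEStronglyMeasurable Y μ ∧ Tendsto (scaledTail p Y μ) atTop (𝓝 0)

/-- `max_{1 ≤ i ≤ N} ‖Sᵢ(m)‖`, where `Sᵢ(m) = ∑_{j < i} m ∘ T ^ j`. -/
noncomputable def maxPartialSum {Ω : Type u} {B : Type v} [NormedAddCommGroup B]
    (T : Ω → Ω) (m : Ω → B) (N : ℕ) (ω : Ω) : ℝ≥0 :=
  (Finset.Icc 1 N).sup fun i => ‖birkhoffSum T m i ω‖₊

/-- `2 ^ (n s / 2) * P (max_{1 ≤ i ≤ 2 ^ n} ‖Sᵢ(m)‖ > 2 ^ n x)`. -/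
noncomputable def weightedDeviation {Ω : Type u} {B : Type v} [NormedAddCommGroup B]
    [MeasurableSpace Ω] (T : Ω → Ω) (m : Ω → B) (μ : Measure Ω) (s x : ℝ) (n : ℕ) : ℝ≥0∞ :=
  ENNReal.ofReal ((2 : ℝ) ^ ((n : ℝ) * s / 2)) *
    μ {ω | (2 : ℝ) ^ n * x < (maxPartialSum T m (2 ^ n) ω : ℝ)}

/-!
Write `X i = m ∘ T^[i]`, `S k = X 0 + ⋯ + X (k - 1)` and `V = condSq 𝓕₀ T m μ`. The proof rests on
a good-λ inequality (`IsMartingaleDifference.measure_lt_norm_sum_le`):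

`P (max ‖S‖ > 2 l) ≤ 4 D δ² P (max ‖S‖ > l) + ∑ P (‖X i‖ > δ l) + P (∑ v i > (δ l)²)`,

where `v i` is the conditional second moment of `X (i + 1)`. It comes from the `(2, D)`-smoothness
inequality applied to the increments that are taken while the running maximum is in `(l, 2 l]` and
the sum of the `v i` is at most `(δ l)²`: this is a predictable selection, hence again a martingale
difference sequence; its second moment is at most `D (δ l)² P (max ‖S‖ > l)`; and its sum has
norm at least `l / 2` whenever `max ‖S‖ > 2 l` and no increment is large. Since `S 0 = 0`, the
increment `X 0` is never selected, so nothing about its conditional mean is needed.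

For a stationary sequence and `l = 2 ^ n * x` the second term is `2 ^ n * P (‖m‖ > δ 2 ^ n x)`.
The third is the tail of an average of the `V ∘ T^[i + 1]`, which Markov's inequality applied to the
excess of `V` over a level `t` bounds by `t⁻¹ E (V - t)₊`, and this is at most a sum
`∑ₖ 2 ^ k P (V > 2 ^ k t)` of tails at dyadic levels (`lintegral_excess_le`). After multiplication
by `2 ^ (n s / 2)` the weighted deviation `f n x` satisfies

`f n (2 x) ≤ 2 ^ (-s - 1) f n x + R n x`,

where `R n x` is built from the sequences `dyadicTail (s / 2 + 1) m` and `dyadicTail (s / 2) V`,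
the latter through a convolution with the summable geometric weights `2 ^ (k (1 - s / 2))`. These
sequences are bounded by weak moments, tend to zero for `L₀^{p,∞}` variables, and are summable with
sum controlled by the strong moments. As the bounds on `R` grow by at most `2 ^ s` when `x` is
halved, iterating the recursion (`le_of_halving`) transfers them to `f n`, to the partial sums of
`∑ f n`, and, with zero remainder, to `limsup f n`, which gives the three assertions.
-/

/-! ### A good-λ inequality for martingales -/

/-- If the walk `S`, started at `0`, exceeds `2 * l` with increments of size at most `d`, then the
increments taken while the running maximum lies in `(l, 2 * l]` have a sum of norm at least `l - d`:
they telescope between the first passages over `l` and over `2 * l`. -/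
lemma sub_le_norm_sum_window {B : Type*} [NormedAddCommGroup B] (X : ℕ → B) (N : ℕ) {l d : ℝ}
    (hl : 0 ≤ l) (hmax : ∃ k ≤ N, 2 * l < ‖∑ j ∈ Finset.range k, X j‖)
    (hX : ∀ i < N, ‖X i‖ ≤ d) (p : ℕ → Prop) [DecidablePred p]
    (hp : ∀ i < N, p i ↔ (∃ k ≤ i, l < ‖∑ j ∈ Finset.range k, X j‖) ∧
      ∀ k ≤ i, ‖∑ j ∈ Finset.range k, X j‖ ≤ 2 * l) :
    l - d ≤ ‖∑ i ∈ Finset.range N, if p i then X i else 0‖ := by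
  classical
  set S : ℕ → B := fun k => ∑ j ∈ Finset.range k, X j with hS
  have hσ : ∃ k, 2 * l < ‖S k‖ := hmax.imp fun k hk => hk.2
  have hτ : ∃ k, l < ‖S k‖ := hσ.imp fun k hk => by linarith
  obtain ⟨σ, hσs, hσm⟩ : ∃ k, 2 * l < ‖S k‖ ∧ ∀ j < k, ‖S j‖ ≤ 2 * l :=
    ⟨Nat.find hσ, Nat.find_spec hσ, fun j hj => not_lt.1 (Nat.find_min hσ hj)⟩
  obtain ⟨τ, hτs, hτm⟩ : ∃ k, l < ‖S k‖ ∧ ∀ j < k, ‖S j‖ ≤ l :=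
    ⟨Nat.find hτ, Nat.find_spec hτ, fun j hj => not_lt.1 (Nat.find_min hτ hj)⟩
  have hσN : σ ≤ N := by
    obtain ⟨k, hk, hk'⟩ := hmax
    by_contra hlt
    exact absurd hk' (not_lt.2 (hσm k (by omega)))
  have hτσ : τ ≤ σ := by
    by_contra hlt
    have := hτm σ (by omega)
    linarith
  have hpi : ∀ i < N, p i ↔ τ ≤ i ∧ i < σ := by
    intro i hi
    rw [hp i hi]
    constructor
    · rintro ⟨⟨k, hk, hk'⟩, h2⟩
      constructor
      · by_contra hlt
        exact absurd hk' (not_lt.2 (hτm k (by omega)))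
      · by_contra hlt
        exact absurd hσs (not_lt.2 (h2 σ (by omega)))
    · rintro ⟨h1, h2⟩
      exact ⟨⟨τ, h1, hτs⟩, fun k hk => hσm k (by omega)⟩
  have hsum : ∑ i ∈ Finset.range N, (if p i then X i else 0) = S σ - S τ := by
    rw [hS]
    dsimp only
    rw [← Finset.sum_Ico_eq_sub X hτσ, ← Finset.sum_filter]
    apply Finset.sum_congr _ fun _ _ => rfl
    ext i
    simp only [Finset.mem_filter, Finset.mem_range, Finset.mem_Ico]
    constructor
    · rintro ⟨h1, h2⟩
      exact (hpi i h1).1 h2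
    · intro h
      exact ⟨by omega, (hpi i (by omega)).2 h⟩
  -- at the passage over `l` the walk overshoots by at most one increment
  have hτb : ‖S τ‖ ≤ l + d := by
    cases τ with
    | zero => simp [hS] at hτs; linarith
    | succ t =>
      have h1 : S (t + 1) = S t + X t := Finset.sum_range_succ _ _
      rw [h1]
      exact (norm_add_le _ _).trans (add_le_add (hτm t (by omega)) (hX t (by omega)))
  rw [hsum]
  have := norm_sub_norm_le (S σ) (S τ)
  linarith

/-- A sum of nonnegative terms, stopped before it exceeds the level `c`, is at most `c`. -/
lemma sum_ite_partial_le (v : ℕ → ℝ≥0∞) (c : ℝ≥0∞) (N : ℕ) :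
    ∑ i ∈ Finset.range N, (if ∑ j ∈ Finset.range (i + 1), v j ≤ c then v i else 0) ≤ c := by
  induction N with
  | zero => simp
  | succ N ih =>
    by_cases h : ∑ j ∈ Finset.range (N + 1), v j ≤ c
    · exact (Finset.sum_le_sum fun i _ => by split_ifs <;> simp).trans h
    · rw [Finset.sum_range_succ, if_neg h, add_zero]
      exact ih

/-- The sequence obtained by switching the terms of a martingale difference sequence on and off
predictably is again a martingale difference sequence. -/
lemma IsMartingaleDifference.indicator {Ω : Type u} {B : Type v} [NormedAddCommGroup B]
    [NormedSpace ℝ B] [CompleteSpace B] {𝓕 : ℕ → MeasurableSpace Ω} [mΩ : MeasurableSpace Ω]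
    {X : ℕ → Ω → B} {μ : Measure Ω} [IsProbabilityMeasure μ]
    (h : IsMartingaleDifference 𝓕 X μ) (E : ℕ → Set Ω) (hE0 : MeasurableSet[𝓕 0] (E 0))
    (hE : ∀ i, MeasurableSet[𝓕 i] (E (i + 1))) :
    IsMartingaleDifference 𝓕 (fun i => (E i).indicator (X i)) μ := by
  have hEi : ∀ i, MeasurableSet[𝓕 i] (E i) := by
    intro i
    cases i with
    | zero => exact hE0
    | succ i => exact h.mono (Nat.le_succ i) _ (hE i)
  refine ⟨h.mono, h.le, fun i => (h.adapted i).indicator (hEi i),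
    fun i => (h.integrable i).indicator (h.le i _ (hEi i)), fun i => ?_⟩
  refine (condExp_indicator (h.integrable (i + 1)) (hE i)).trans ?_
  filter_upwards [h.condExp_eq_zero i] with ω hω
  simp [hω]

/-- **Good-λ inequality.** Here `v i` dominates the conditional second moment of `X (i + 1)` given
`𝓕 i`, a condition stated through integrals over events of `𝓕 i`. -/
lemma IsMartingaleDifference.measure_lt_norm_sum_le {Ω : Type u} {B : Type v}
    [NormedAddCommGroup B] [NormedSpace ℝ B] [CompleteSpace B] {D : ℝ≥0}
    (hB : IsRDSmooth.{u, v} B 2 D)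
    {𝓕 : ℕ → MeasurableSpace Ω} [mΩ : MeasurableSpace Ω]
    {X : ℕ → Ω → B} {μ : Measure Ω} [IsProbabilityMeasure μ]
    (h : IsMartingaleDifference 𝓕 X μ) {v : ℕ → Ω → ℝ≥0∞}
    (hv : ∀ i, Measurable[𝓕 i] (v i))
    (hXv : ∀ i (E : Set Ω), MeasurableSet[𝓕 i] E →
      ∫⁻ ω in E, ‖X (i + 1) ω‖ₑ ^ (2 : ℝ) ∂μ ≤ ∫⁻ ω in E, v i ω ∂μ)
    (N : ℕ) {l δ : ℝ} (hl : 0 < l) (hδ2 : δ ≤ 1 / 2) :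
    μ {ω | ∃ k ≤ N, 2 * l < ‖∑ j ∈ Finset.range k, X j ω‖} ≤
      ENNReal.ofReal (4 * D * δ ^ 2) * μ {ω | ∃ k ≤ N, l < ‖∑ j ∈ Finset.range k, X j ω‖} +
      ∑ i ∈ Finset.range N, μ {ω | δ * l < ‖X i ω‖} +
      μ {ω | ENNReal.ofReal ((δ * l) ^ 2) < ∑ i ∈ Finset.range N, v i ω} := by
  classical
  set S : ℕ → Ω → B := fun k ω => ∑ j ∈ Finset.range k, X j ω with hS
  set c : ℝ≥0∞ := ENNReal.ofReal ((δ * l) ^ 2) with hc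
  -- while `E i` occurs, the running maximum is in `(l, 2 * l]` and the quadratic variation is low
  set E : ℕ → Set Ω := fun i => {ω | ((∃ k ≤ i, l < ‖S k ω‖) ∧ ∀ k ≤ i, ‖S k ω‖ ≤ 2 * l) ∧
    ∑ j ∈ Finset.range i, v j ω ≤ c} with hEdef
  have hE0 : E 0 = ∅ := by
    ext ω
    simp only [hEdef, hS, Set.mem_ofPred_eq, Set.mem_empty_iff_false, iff_false]
    rintro ⟨⟨⟨k, hk, hk'⟩, -⟩, -⟩
    obtain rfl : k = 0 := by omega
    simp at hk'
    linarith
  have hSm : ∀ i, ∀ k ≤ i + 1, StronglyMeasurable[𝓕 i] (S k) := by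
    intro i k hk
    refine Finset.stronglyMeasurable_fun_sum (m := 𝓕 i) _ fun j hj => ?_
    exact (h.adapted j).mono (h.mono (by have := Finset.mem_range.1 hj; omega))
  have hSn : ∀ i, ∀ k ≤ i + 1, Measurable[𝓕 i] fun ω => ‖S k ω‖ := fun i k hk =>
    (hSm i k hk).norm.measurable
  have hEm : ∀ i, MeasurableSet[𝓕 i] (E (i + 1)) := by
    intro i
    have h1 : MeasurableSet[𝓕 i] {ω | ∃ k ≤ i + 1, l < ‖S k ω‖} := by
      have : {ω | ∃ k ≤ i + 1, l < ‖S k ω‖} = ⋃ k ∈ Set.Iic (i + 1), {ω | l < ‖S k ω‖} := by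
        ext; simp
      rw [this]
      exact MeasurableSet.biUnion (Set.to_countable _) fun k hk =>
        measurableSet_lt measurable_const (hSn i k hk)
    have h2 : MeasurableSet[𝓕 i] {ω | ∀ k ≤ i + 1, ‖S k ω‖ ≤ 2 * l} := by
      have : {ω | ∀ k ≤ i + 1, ‖S k ω‖ ≤ 2 * l} =
          ⋂ k ∈ Set.Iic (i + 1), {ω | ‖S k ω‖ ≤ 2 * l} := by
        ext; simp
      rw [this]
      exact MeasurableSet.biInter (Set.to_countable _) fun k hk =>
        measurableSet_le (hSn i k hk) measurable_const
    have h3 : Measurable[𝓕 i] fun ω => ∑ j ∈ Finset.range (i + 1), v j ω :=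
      Finset.measurable_fun_sum _ fun j hj =>
        (hv j).mono (h.mono (by have := Finset.mem_range.1 hj; omega)) le_rfl
    exact (h1.inter h2).inter (measurableSet_le h3 measurable_const)
  have hZ := h.indicator E (by rw [hE0]; exact @MeasurableSet.empty _ (𝓕 0)) hEm
  have hmom := hB.moment_le Ω 𝓕 μ _ hZ N
  set U : Ω → B := fun ω => ∑ i ∈ Finset.range N, (E i).indicator (X i) ω with hU
  set A : Set Ω := {ω | ∃ k ≤ N, l < ‖S k ω‖} with hA
  have hAm : MeasurableSet A := by
    have : A = ⋃ k ∈ Set.Iic N, {ω | l < ‖S k ω‖} := by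
      ext; simp [hA]
    rw [this]
    exact MeasurableSet.biUnion (Set.to_countable _) fun k hk =>
      measurableSet_lt measurable_const ((hSn k k (by omega)).mono (h.le k) le_rfl)
  have hsum : ∑ i ∈ Finset.range N, ∫⁻ ω, ‖(E i).indicator (X i) ω‖ₑ ^ (2 : ℝ) ∂μ ≤ c * μ A := by
    have hterm : ∀ i, ∫⁻ ω, ‖(E i).indicator (X i) ω‖ₑ ^ (2 : ℝ) ∂μ =
        ∫⁻ ω, (E i).indicator (fun ω => ‖X i ω‖ₑ ^ (2 : ℝ)) ω ∂μ := by
      intro i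
      congr 1
      ext ω
      by_cases hω : ω ∈ E i <;> simp [hω]
    cases N with
    | zero => simp
    | succ N =>
      rw [Finset.sum_range_succ', hE0]
      simp only [Set.indicator_empty, enorm_zero]
      rw [ENNReal.zero_rpow_of_pos two_pos, lintegral_zero, add_zero]
      calc ∑ i ∈ Finset.range N, ∫⁻ ω, ‖(E (i + 1)).indicator (X (i + 1)) ω‖ₑ ^ (2 : ℝ) ∂μ
          ≤ ∑ i ∈ Finset.range N, ∫⁻ ω, (E (i + 1)).indicator (v i) ω ∂μ := by
            refine Finset.sum_le_sum fun i _ => ?_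
            rw [hterm, lintegral_indicator (h.le i _ (hEm i)),
              lintegral_indicator (h.le i _ (hEm i))]
            exact hXv i _ (hEm i)
        _ = ∫⁻ ω, ∑ i ∈ Finset.range N, (E (i + 1)).indicator (v i) ω ∂μ := by
            rw [lintegral_finsetSum]
            exact fun i _ => ((hv i).mono (h.le i) le_rfl).indicator (h.le i _ (hEm i))
        _ ≤ ∫⁻ ω, A.indicator (fun _ => c) ω ∂μ := by
            refine lintegral_mono fun ω => ?_
            by_cases hω : ω ∈ A
            · rw [Set.indicator_of_mem hω]
              refine le_trans (Finset.sum_le_sum fun i _ => ?_)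
                (sum_ite_partial_le (fun i => v i ω) c N)
              by_cases hi : ω ∈ E (i + 1)
              · rw [Set.indicator_of_mem hi, if_pos hi.2]
              · rw [Set.indicator_of_notMem hi]; exact zero_le
            · rw [Set.indicator_of_notMem hω]
              refine (Finset.sum_eq_zero fun i hi => ?_).le
              refine Set.indicator_of_notMem (fun hi' => hω ?_) _
              obtain ⟨⟨⟨k, hk, hk'⟩, -⟩, -⟩ := hi'
              exact ⟨k, by have := Finset.mem_range.1 hi; omega, hk'⟩
        _ = c * μ A := by rw [lintegral_indicator hAm, setLIntegral_const]
  have hUm : AEMeasurable (fun ω => ‖U ω‖ₑ ^ (2 : ℝ)) μ := by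
    have : AEStronglyMeasurable U μ :=
      Finset.aestronglyMeasurable_fun_sum _ fun i _ => (hZ.integrable i).aestronglyMeasurable
    exact this.enorm.pow_const _
  have hG : μ {ω | l / 2 ≤ ‖U ω‖} ≤ ENNReal.ofReal (4 * D * δ ^ 2) * μ A := by
    have hlne : ENNReal.ofReal ((l / 2) ^ 2) ≠ 0 := by
      simpa using by positivity
    rw [← ENNReal.mul_le_mul_iff_right hlne ENNReal.ofReal_ne_top]
    calc ENNReal.ofReal ((l / 2) ^ 2) * μ {ω | l / 2 ≤ ‖U ω‖}
        ≤ ENNReal.ofReal ((l / 2) ^ 2) *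
            μ {ω | ENNReal.ofReal ((l / 2) ^ 2) ≤ ‖U ω‖ₑ ^ (2 : ℝ)} := by
          gcongr with ω
          intro hω
          rw [← ofReal_norm, ENNReal.ofReal_rpow_of_nonneg (norm_nonneg _) two_pos.le]
          apply ENNReal.ofReal_le_ofReal
          rw [Real.rpow_two]
          gcongr
      _ ≤ ∫⁻ ω, ‖U ω‖ₑ ^ (2 : ℝ) ∂μ := mul_meas_ge_le_lintegral₀ hUm _
      _ ≤ D * (c * μ A) := hmom.trans (by gcongr)
      _ = ENNReal.ofReal ((l / 2) ^ 2) * (ENNReal.ofReal (4 * D * δ ^ 2) * μ A) := by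
          rw [← mul_assoc, ← mul_assoc, hc, ← ENNReal.ofReal_coe_nnreal,
            ← ENNReal.ofReal_mul (by positivity), ← ENNReal.ofReal_mul (by positivity)]
          congr 2
          ring
  calc μ {ω | ∃ k ≤ N, 2 * l < ‖S k ω‖}
      ≤ μ (({ω | l / 2 ≤ ‖U ω‖} ∪ ⋃ i ∈ Finset.range N, {ω | δ * l < ‖X i ω‖}) ∪
          {ω | c < ∑ i ∈ Finset.range N, v i ω}) := by
        refine measure_mono fun ω hω => ?_
        by_contra hcon
        simp only [Set.mem_union, Set.mem_ofPred_eq, Set.mem_iUnion, not_or, not_exists, not_lt,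
          not_le, Finset.mem_range] at hcon
        obtain ⟨⟨h1, h2⟩, h3⟩ := hcon
        have := sub_le_norm_sum_window (fun i => X i ω) N hl.le hω (fun i hi => h2 i hi)
          (fun i => ω ∈ E i) (fun i hi => ?_)
        · simp only [hU, Set.indicator_apply] at h1
          have h4 : δ * l ≤ 1 / 2 * l := by gcongr
          linarith
        · refine ⟨fun hi' => hi'.1, fun hi' => ⟨hi', le_trans ?_ h3⟩⟩
          exact Finset.sum_le_sum_of_subset (Finset.range_mono hi.le)
    _ ≤ _ := by
        refine (measure_union_le _ _).trans (add_le_add ((measure_union_le _ _).trans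
          (add_le_add hG (measure_biUnion_finset_le _ _))) le_rfl)

/-! ### Tails along dyadic levels -/

/-- The tail `P (‖Y‖ > 2 ^ n * y)`, weighted by `(2 ^ n) ^ p`. -/
noncomputable def dyadicTail {Ω : Type u} {E : Type v} [NormedAddCommGroup E]
    [MeasurableSpace Ω] (p : ℝ) (Y : Ω → E) (μ : Measure Ω) (y : ℝ) (n : ℕ) : ℝ≥0∞ :=
  ENNReal.ofReal (((2 : ℝ) ^ n) ^ p) * μ {ω | (2 : ℝ) ^ n * y < ‖Y ω‖}

section Tails

variable {Ω : Type u} {E : Type v} [NormedAddCommGroup E] [MeasurableSpace Ω] {p : ℝ} {Y : Ω → E}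
  {μ : Measure Ω} {y : ℝ}

lemma dyadicTail_eq (hy : 0 < y) (n : ℕ) :
    dyadicTail p Y μ y n = ENNReal.ofReal (y ^ (-p)) * scaledTail p Y μ ((2 : ℝ) ^ n * y) := by
  rw [dyadicTail, scaledTail, ← mul_assoc, ← ENNReal.ofReal_mul (by positivity),
    Real.mul_rpow (by positivity) hy.le, Real.rpow_neg hy.le]
  congr 2
  field_simp

lemma dyadicTail_le_weakMoment (hy : 0 < y) (n : ℕ) :
    dyadicTail p Y μ y n ≤ ENNReal.ofReal (y ^ (-p)) * weakMoment p Y μ := by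
  rw [dyadicTail_eq hy]
  gcongr
  exact le_iSup₂_of_le ((2 : ℝ) ^ n * y) (by positivity) le_rfl

lemma tendsto_dyadicTail (hY : MemWeakLpZero p Y μ) (hy : 0 < y) :
    Tendsto (dyadicTail p Y μ y) atTop (𝓝 0) := by
  have h1 : Tendsto (fun n : ℕ => (2 : ℝ) ^ n * y) atTop atTop :=
    (tendsto_pow_atTop_atTop_of_one_lt one_lt_two).atTop_mul_const hy
  have h2 := ENNReal.Tendsto.const_mul (a := ENNReal.ofReal (y ^ (-p))) (hY.2.comp h1)
    (Or.inr ENNReal.ofReal_ne_top)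
  rw [mul_zero] at h2
  exact h2.congr fun n => (dyadicTail_eq hy n).symm

lemma MemWeakLpZero.memWeakLp [IsProbabilityMeasure μ] (hp : 0 ≤ p) (hY : MemWeakLpZero p Y μ) :
    MemWeakLp p Y μ := by
  refine ⟨hY.1, ?_⟩
  obtain ⟨t₀, ht₀⟩ := eventually_atTop.1 (hY.2.eventually (gt_mem_nhds zero_lt_one))
  refine lt_of_le_of_lt (b := max 1 (ENNReal.ofReal (t₀ ^ p))) (iSup₂_le fun t ht => ?_)
    (max_lt ENNReal.one_lt_top ENNReal.ofReal_lt_top)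
  rcases le_total t₀ t with h | h
  · exact le_max_of_le_left (ht₀ t h).le
  · refine le_max_of_le_right ?_
    calc scaledTail p Y μ t ≤ ENNReal.ofReal (t ^ p) * 1 := by
          rw [scaledTail]; gcongr; exact prob_le_one
      _ ≤ _ := by rw [mul_one]; gcongr

lemma sum_dyadic_lt_le (hp : 0 < p) {r : ℝ} (hr : 0 ≤ r) (N : ℕ) :
    ∑ n ∈ Finset.range N, (if (2 : ℝ) ^ n < r then ((2 : ℝ) ^ n) ^ p else 0) ≤
      (2 : ℝ) ^ p / (2 ^ p - 1) * r ^ p := by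
  have hρ : (1 : ℝ) < 2 ^ p := Real.one_lt_rpow one_lt_two hp
  have hρ' : (0 : ℝ) < 2 ^ p - 1 := by linarith
  have hpow : ∀ n : ℕ, ((2 : ℝ) ^ n) ^ p = (2 ^ p) ^ n := fun n => by
    rw [← Real.rpow_natCast, ← Real.rpow_natCast, ← Real.rpow_mul two_pos.le,
      ← Real.rpow_mul two_pos.le, mul_comm]
  induction N with
  | zero => simp; positivity
  | succ N ih =>
    by_cases h : (2 : ℝ) ^ N < r
    · calc ∑ n ∈ Finset.range (N + 1), (if (2 : ℝ) ^ n < r then ((2 : ℝ) ^ n) ^ p else 0)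
          ≤ ∑ n ∈ Finset.range (N + 1), ((2 : ℝ) ^ p) ^ n := by
            refine Finset.sum_le_sum fun n _ => ?_
            rw [hpow]
            split_ifs
            · exact le_rfl
            · positivity
        _ = (((2 : ℝ) ^ p) ^ (N + 1) - 1) / (2 ^ p - 1) := geom_sum_eq hρ.ne' _
        _ ≤ ((2 : ℝ) ^ p) ^ (N + 1) / (2 ^ p - 1) := by gcongr; linarith
        _ = (2 : ℝ) ^ p / (2 ^ p - 1) * ((2 : ℝ) ^ N) ^ p := by rw [hpow, pow_succ]; ring
        _ ≤ _ := by gcongr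
    · rw [Finset.sum_range_succ, if_neg h, add_zero]
      exact ih

lemma tsum_dyadicTail_le (hp : 0 < p) (hY : AEStronglyMeasurable Y μ) (hy : 0 < y) :
    ∑' n, dyadicTail p Y μ y n ≤ ENNReal.ofReal ((2 : ℝ) ^ p / (2 ^ p - 1)) *
      (ENNReal.ofReal (y ^ (-p)) * ∫⁻ ω, ‖Y ω‖ₑ ^ p ∂μ) := by
  have hm : ∀ n : ℕ, NullMeasurableSet {ω | (2 : ℝ) ^ n * y < ‖Y ω‖} μ := fun n =>
    nullMeasurableSet_lt aemeasurable_const hY.norm.aemeasurable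
  have hc : (0 : ℝ) ≤ 2 ^ p / (2 ^ p - 1) := by
    have : (1 : ℝ) < 2 ^ p := Real.one_lt_rpow one_lt_two hp
    exact div_nonneg (by positivity) (by linarith)
  refine ENNReal.tsum_le_of_sum_range_le fun N => ?_
  calc ∑ n ∈ Finset.range N, dyadicTail p Y μ y n
      = ∑ n ∈ Finset.range N, ∫⁻ ω, {ω | (2 : ℝ) ^ n * y < ‖Y ω‖}.indicator
          (fun _ => ENNReal.ofReal (((2 : ℝ) ^ n) ^ p)) ω ∂μ := by
        refine Finset.sum_congr rfl fun n _ => ?_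
        rw [lintegral_indicator₀ (hm n), setLIntegral_const, dyadicTail]
    _ = ∫⁻ ω, ∑ n ∈ Finset.range N, {ω | (2 : ℝ) ^ n * y < ‖Y ω‖}.indicator
          (fun _ => ENNReal.ofReal (((2 : ℝ) ^ n) ^ p)) ω ∂μ := by
        rw [lintegral_finsetSum']
        exact fun n _ => aemeasurable_const.indicator₀ (hm n)
    _ ≤ ∫⁻ ω, ENNReal.ofReal ((2 : ℝ) ^ p / (2 ^ p - 1)) *
          (ENNReal.ofReal (y ^ (-p)) * ‖Y ω‖ₑ ^ p) ∂μ := by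
        refine lintegral_mono fun ω => ?_
        have h1 := ENNReal.ofReal_le_ofReal
          (sum_dyadic_lt_le hp (r := ‖Y ω‖ / y) (by positivity) N)
        rw [ENNReal.ofReal_sum_of_nonneg fun n _ => by split_ifs <;> positivity,
          ENNReal.ofReal_mul hc, div_eq_inv_mul ‖Y ω‖, Real.mul_rpow (by positivity) (by positivity),
          Real.inv_rpow hy.le, ← Real.rpow_neg hy.le, ENNReal.ofReal_mul (by positivity),
          ← ENNReal.ofReal_rpow_of_nonneg (norm_nonneg _) hp.le, ofReal_norm] at h1
        refine le_trans (Finset.sum_le_sum fun n _ => ?_) h1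
        simp only [Set.indicator_apply, Set.mem_ofPred_eq, ← div_eq_inv_mul, lt_div_iff₀ hy]
        split_ifs <;> simp
    _ = _ := by
        rw [lintegral_const_mul' _ _ ENNReal.ofReal_ne_top,
          lintegral_const_mul' _ _ ENNReal.ofReal_ne_top]

lemma sub_le_sum_dyadic {a t : ℝ} (ht : 0 < t) (N : ℕ) (h : a ≤ (2 : ℝ) ^ N * t) :
    a - t ≤ ∑ k ∈ Finset.range N, (if (2 : ℝ) ^ k * t < a then (2 : ℝ) ^ k * t else 0) := by
  induction N with
  | zero => simpa using h
  | succ N ih =>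
    by_cases h' : a ≤ (2 : ℝ) ^ N * t
    · rw [Finset.sum_range_succ, if_neg (not_lt.2 h'), add_zero]
      exact ih h'
    · have h1 : ∀ k ∈ Finset.range (N + 1),
          (if (2 : ℝ) ^ k * t < a then (2 : ℝ) ^ k * t else 0) = (2 : ℝ) ^ k * t := fun k hk => by
        refine if_pos (lt_of_le_of_lt ?_ (not_le.1 h'))
        gcongr
        · exact one_le_two
        · have := Finset.mem_range.1 hk; omega
      rw [Finset.sum_congr rfl h1, ← Finset.sum_mul, geom_sum_eq (by norm_num)]
      linarith

/-- The expectation of the excess of `Y` over `2 ^ n * y` is controlled by the tails of `Y` at the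
higher dyadic levels, with geometrically decreasing weights as soon as `1 < p`. -/
lemma lintegral_excess_le {Y : Ω → ℝ} (hY : AEStronglyMeasurable Y μ) (hy : 0 < y) (n : ℕ) :
    ENNReal.ofReal (((2 : ℝ) ^ n) ^ p) * ((ENNReal.ofReal ((2 : ℝ) ^ n * y))⁻¹ *
      ∫⁻ ω, (ENNReal.ofReal (Y ω) - ENNReal.ofReal ((2 : ℝ) ^ n * y)) ∂μ) ≤
      ∑' k, ENNReal.ofReal ((2 : ℝ) ^ (1 - p)) ^ k * dyadicTail p Y μ y (n + k) := by
  set t : ℝ := (2 : ℝ) ^ n * y with ht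
  have ht0 : 0 < t := by positivity
  have hm : ∀ k : ℕ, NullMeasurableSet {ω | (2 : ℝ) ^ k * t < ‖Y ω‖} μ := fun k =>
    nullMeasurableSet_lt aemeasurable_const hY.norm.aemeasurable
  have h1 : ∫⁻ ω, (ENNReal.ofReal (Y ω) - ENNReal.ofReal t) ∂μ ≤
      ∑' k : ℕ, ENNReal.ofReal ((2 : ℝ) ^ k * t) * μ {ω | (2 : ℝ) ^ k * t < ‖Y ω‖} := by
    calc ∫⁻ ω, (ENNReal.ofReal (Y ω) - ENNReal.ofReal t) ∂μ
        ≤ ∫⁻ ω, ∑' k : ℕ, {ω | (2 : ℝ) ^ k * t < ‖Y ω‖}.indicator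
            (fun _ => ENNReal.ofReal ((2 : ℝ) ^ k * t)) ω ∂μ := by
          refine lintegral_mono fun ω => ?_
          obtain ⟨N, hN⟩ := pow_unbounded_of_one_lt (Y ω / t) one_lt_two
          rw [← ENNReal.ofReal_sub _ ht0.le]
          refine le_trans (ENNReal.ofReal_le_ofReal (sub_le_sum_dyadic ht0 N
            ((div_lt_iff₀ ht0).1 hN).le)) (le_trans ?_ (ENNReal.sum_le_tsum (Finset.range N)))
          rw [ENNReal.ofReal_sum_of_nonneg fun k _ => by split_ifs <;> positivity]
          refine Finset.sum_le_sum fun k _ => ?_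
          split_ifs with h
          · rw [Set.indicator_of_mem]
            exact h.trans_le (Real.le_norm_self _)
          · simp
      _ = _ := by
          rw [lintegral_tsum fun k => aemeasurable_const.indicator₀ (hm k)]
          refine tsum_congr fun k => ?_
          rw [lintegral_indicator₀ (hm k), setLIntegral_const]
  refine (mul_le_mul_right (mul_le_mul_right h1 _) _).trans (le_of_eq ?_)
  rw [← ENNReal.tsum_mul_left, ← ENNReal.tsum_mul_left]
  refine tsum_congr fun k => ?_
  rw [dyadicTail, ← ENNReal.ofReal_inv_of_pos ht0, ← ENNReal.ofReal_pow (by positivity)]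
  simp only [← mul_assoc]
  rw [← ENNReal.ofReal_mul (by positivity), ← ENNReal.ofReal_mul (by positivity),
    ← ENNReal.ofReal_mul (by positivity)]
  congr 2
  · have h2 : (((2 : ℝ) ^ (1 - p)) ^ k) * ((2 : ℝ) ^ k) ^ p = 2 ^ k := by
      rw [← Real.rpow_natCast, ← Real.rpow_natCast, ← Real.rpow_mul two_pos.le,
        ← Real.rpow_mul two_pos.le, ← Real.rpow_add two_pos]
      congr 1; ring
    rw [pow_add, Real.mul_rpow (by positivity) (by positivity)]
    linear_combination
      ((2 : ℝ) ^ n) ^ p * 2 ^ k * inv_mul_cancel₀ ht0.ne' - ((2 : ℝ) ^ n) ^ p * h2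
  · rw [ht, pow_add]
    congr! 3
    ring

end Tails

section Geometric

variable {c : ℝ≥0∞} {b : ℕ → ℝ≥0∞}

lemma tsum_geometric_mul_shift_le {M : ℝ≥0∞} (n : ℕ) (hb : ∀ k, b (n + k) ≤ M) :
    ∑' k, c ^ k * b (n + k) ≤ (1 - c)⁻¹ * M := by
  rw [← ENNReal.tsum_geometric, ← ENNReal.tsum_mul_right]
  exact ENNReal.tsum_le_tsum fun k => by gcongr; exact hb k

lemma tendsto_tsum_geometric_mul_shift (hc : c < 1) (hb : Tendsto b atTop (𝓝 0)) :
    Tendsto (fun n => ∑' k, c ^ k * b (n + k)) atTop (𝓝 0) := by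
  have hc' : (1 - c)⁻¹ ≠ ∞ := ENNReal.inv_ne_top.2 (tsub_pos_of_lt hc).ne'
  have hc0 : (1 - c)⁻¹ ≠ 0 := ENNReal.inv_ne_zero.2 (by finiteness)
  rw [ENNReal.tendsto_nhds_zero] at hb ⊢
  intro ε hε
  obtain ⟨n₀, hn₀⟩ := eventually_atTop.1 (hb (ε / (1 - c)⁻¹) (ENNReal.div_pos hε.ne' hc'))
  filter_upwards [eventually_ge_atTop n₀] with n hn
  refine (tsum_geometric_mul_shift_le n fun k => hn₀ (n + k) (by omega)).trans ?_
  rw [ENNReal.mul_div_cancel hc0 hc']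

lemma tsum_tsum_geometric_mul_shift_le :
    ∑' n, ∑' k, c ^ k * b (n + k) ≤ (1 - c)⁻¹ * ∑' n, b n := by
  rw [ENNReal.tsum_comm, ← ENNReal.tsum_geometric, ← ENNReal.tsum_mul_right]
  refine ENNReal.tsum_le_tsum fun k => ?_
  rw [ENNReal.tsum_mul_left]
  exact mul_le_mul_right (ENNReal.tsum_comp_le_tsum_of_injective (add_left_injective k) b) _

end Geometric

/-! ### Square integrability from weak moments -/

lemma weakMoment_norm_sq_le {Ω : Type u} {E : Type v} [NormedAddCommGroup E] [MeasurableSpace Ω]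
    {μ : Measure Ω} (p : ℝ) (Y : Ω → E) :
    weakMoment (p / 2) (fun ω => ‖Y ω‖ ^ 2) μ ≤ weakMoment p Y μ := by
  refine iSup₂_le fun t ht => le_iSup₂_of_le (√t) (Real.sqrt_pos.2 ht) (le_of_eq ?_)
  rw [scaledTail, scaledTail, Real.sqrt_eq_rpow, ← Real.rpow_mul ht.le, one_div_mul_eq_div]
  congr! 4 with ω
  rw [← Real.sqrt_eq_rpow, norm_pow, norm_norm, Real.sqrt_lt ht.le (norm_nonneg _)]

lemma MemWeakLp.integrable_norm_sq {Ω : Type u} {E : Type v} [NormedAddCommGroup E]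
    [MeasurableSpace Ω] {μ : Measure Ω} [IsProbabilityMeasure μ] {p : ℝ} {Y : Ω → E} (hp : 2 < p)
    (hY : MemWeakLp p Y μ) : Integrable (fun ω => ‖Y ω‖ ^ 2) μ := by
  have hm : AEStronglyMeasurable (fun ω => ‖Y ω‖ ^ 2) μ := hY.1.norm.pow 2
  have hc : ENNReal.ofReal ((2 : ℝ) ^ (1 - p / 2)) < 1 := by
    rw [ENNReal.ofReal_lt_one]
    exact Real.rpow_lt_one_of_one_lt_of_neg one_lt_two (by linarith)
  have h1 := (lintegral_excess_le (p := p / 2) hm one_pos 0).trans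
    (tsum_geometric_mul_shift_le 0 fun k => dyadicTail_le_weakMoment one_pos _)
  simp only [pow_zero, Real.one_rpow, ENNReal.ofReal_one, mul_one, inv_one, one_mul] at h1
  refine ⟨hm, ?_⟩
  rw [hasFiniteIntegral_iff_ofReal (ae_of_all _ fun ω => by positivity)]
  calc ∫⁻ ω, ENNReal.ofReal (‖Y ω‖ ^ 2) ∂μ
      ≤ ∫⁻ ω, ((ENNReal.ofReal (‖Y ω‖ ^ 2) - 1) + 1) ∂μ :=
        lintegral_mono fun ω => le_tsub_add
    _ = ∫⁻ ω, (ENNReal.ofReal (‖Y ω‖ ^ 2) - 1) ∂μ + 1 := by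
        rw [lintegral_add_right _ measurable_const]; simp
    _ < ∞ := by
        refine ENNReal.add_lt_top.2 ⟨h1.trans_lt (ENNReal.mul_lt_top ?_ ?_), ENNReal.one_lt_top⟩
        · exact (ENNReal.inv_ne_top.2 (tsub_pos_of_lt hc).ne').lt_top
        · exact (weakMoment_norm_sq_le p Y).trans_lt hY.2

/-! ### Iterating the good-λ inequality -/

/-- If `φ` grows at most by the factor `2 ^ s` under halving, and `f (2 * x)` is at most
`2 ^ (-s - 1) * f x + φ x`, then `f` is at most a multiple of `φ`, provided that the contribution of
`f` itself vanishes when the recursion is iterated. -/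
lemma le_of_halving {f φ : ℝ → ℝ≥0∞} {s : ℝ}
    (hφ : ∀ x, 0 < x → φ (x / 2) ≤ ENNReal.ofReal (2 ^ s) * φ x)
    (hf : ∀ x, 0 < x → f (2 * x) ≤ ENNReal.ofReal (2 ^ (-s - 1)) * f x + φ x)
    (hlim : ∀ x, 0 < x →
      Tendsto (fun k : ℕ => ENNReal.ofReal (2 ^ (-s - 1)) ^ k * f (x / 2 ^ k)) atTop (𝓝 0))
    {x : ℝ} (hx : 0 < x) : f x ≤ ENNReal.ofReal (2 ^ (s + 1)) * φ x := by
  have key : ∀ (k : ℕ) (x : ℝ), 0 < x → f x ≤ ENNReal.ofReal (2 ^ (s + 1)) * φ x +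
      ENNReal.ofReal (2 ^ (-s - 1)) ^ k * f (x / 2 ^ k) := by
    intro k
    induction k with
    | zero => intro x _; simp
    | succ k ih =>
      intro x hx
      have h1 := hf (x / 2) (by positivity)
      rw [mul_div_cancel₀ x two_ne_zero] at h1
      refine h1.trans ((add_le_add (mul_le_mul_right (ih (x / 2) (by positivity)) _)
        le_rfl).trans ?_)
      have h2 : x / 2 / 2 ^ k = x / 2 ^ (k + 1) := by rw [pow_succ]; field_simp
      have h3 : ENNReal.ofReal (2 ^ (-s - 1)) * (ENNReal.ofReal (2 ^ (s + 1)) * φ (x / 2)) =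
          φ (x / 2) := by
        rw [← mul_assoc, ← ENNReal.ofReal_mul (by positivity), ← Real.rpow_add two_pos]
        norm_num
      have h4 : φ (x / 2) + φ (x / 2) ≤ ENNReal.ofReal (2 ^ (s + 1)) * φ x := by
        refine (add_le_add (hφ x hx) (hφ x hx)).trans (le_of_eq ?_)
        rw [← add_mul, ← ENNReal.ofReal_add (by positivity) (by positivity),
          Real.rpow_add two_pos, Real.rpow_one, mul_two]
      rw [mul_add, h3, h2, ← mul_assoc, ← pow_succ', add_right_comm]
      gcongr
  have h := ge_of_tendsto' ((hlim x hx).const_add (ENNReal.ofReal (2 ^ (s + 1)) * φ x))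
    fun k => key k x hx
  rwa [add_zero] at h

lemma tendsto_pow_mul_of_le_const {f : ℝ → ℝ≥0∞} {ε M : ℝ≥0∞} (hε : ε < 1) (hM : M ≠ ∞)
    (hf : ∀ x, f x ≤ M) (x : ℝ) : Tendsto (fun k : ℕ => ε ^ k * f (x / 2 ^ k)) atTop (𝓝 0) := by
  have h := ENNReal.Tendsto.mul_const (b := M) (ENNReal.tendsto_pow_atTop_nhds_zero_of_lt_one hε)
    (Or.inr hM)
  rw [zero_mul] at h
  exact tendsto_of_tendsto_of_tendsto_of_le_of_le tendsto_const_nhds h (fun _ => zero_le)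
    fun k => mul_le_mul_right (hf _) _

lemma tendsto_pow_mul_of_halving {f φ : ℝ → ℝ≥0∞} {s : ℝ}
    (hφ : ∀ x, 0 < x → φ (x / 2) ≤ ENNReal.ofReal (2 ^ s) * φ x) {x : ℝ} (hx : 0 < x)
    (hφx : φ x ≠ ∞) (hf : ∀ x, 0 < x → f x ≤ φ x) :
    Tendsto (fun k : ℕ => ENNReal.ofReal (2 ^ (-s - 1)) ^ k * f (x / 2 ^ k)) atTop (𝓝 0) := by
  have hk : ∀ k : ℕ, φ (x / 2 ^ k) ≤ ENNReal.ofReal (2 ^ s) ^ k * φ x := by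
    intro k
    induction k with
    | zero => simp
    | succ k ih =>
      have h1 : x / 2 ^ (k + 1) = x / 2 ^ k / 2 := by rw [pow_succ]; field_simp
      rw [h1]
      refine (hφ _ (by positivity)).trans ((mul_le_mul_right ih _).trans (le_of_eq ?_))
      rw [← mul_assoc, ← pow_succ']
  have h2 : ENNReal.ofReal (2 ^ (-s - 1)) * ENNReal.ofReal (2 ^ s) = 2⁻¹ := by
    rw [← ENNReal.ofReal_mul (by positivity), ← Real.rpow_add two_pos,
      show -s - 1 + s = -1 by ring, Real.rpow_neg_one, ENNReal.ofReal_inv_of_pos two_pos,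
      ENNReal.ofReal_ofNat]
  have h := ENNReal.Tendsto.mul_const (b := φ x)
    (ENNReal.tendsto_pow_atTop_nhds_zero_of_lt_one (ENNReal.inv_lt_one.2 ENNReal.one_lt_two))
    (Or.inr hφx)
  rw [zero_mul] at h
  refine tendsto_of_tendsto_of_tendsto_of_le_of_le tendsto_const_nhds h (fun _ => zero_le)
    fun k => ?_
  dsimp only
  rw [← h2, mul_pow, mul_assoc]
  exact mul_le_mul_right ((hf _ (by positivity)).trans (hk k)) _

lemma limsup_mul_add_le {u r : ℕ → ℝ≥0∞} {a : ℝ≥0∞} (ha : a ≠ ∞) (hr : Tendsto r atTop (𝓝 0)) :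
    limsup (fun n => a * u n + r n) atTop ≤ a * limsup u atTop := by
  refine ENNReal.le_of_forall_pos_le_add fun ε hε _ => ?_
  rw [← ENNReal.limsup_const_mul_of_ne_top ha, ← limsup_add_const _ _ _ (by isBoundedDefault)
    (by isBoundedDefault)]
  refine limsup_le_limsup ?_
  filter_upwards [hr.eventually (ge_mem_nhds (ENNReal.coe_pos.2 hε))] with n hn
  gcongr

/-! ### Stationary sequences -/

lemma lt_maxPartialSum_iff {Ω : Type u} {B : Type v} [NormedAddCommGroup B] (T : Ω → Ω)
    (m : Ω → B) (N : ℕ) (ω : Ω) {l : ℝ} (hl : 0 < l) :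
    l < (maxPartialSum T m N ω : ℝ) ↔
      ∃ k ≤ N, l < ‖∑ j ∈ Finset.range k, (m ∘ T^[j]) ω‖ := by
  lift l to ℝ≥0 using hl.le
  rw [maxPartialSum, NNReal.coe_lt_coe, Finset.lt_sup_iff]
  constructor
  · rintro ⟨k, hk, h⟩
    exact ⟨k, (Finset.mem_Icc.1 hk).2, NNReal.coe_lt_coe.2 h⟩
  · rintro ⟨k, hk, h⟩
    refine ⟨k, Finset.mem_Icc.2 ⟨?_, hk⟩, NNReal.coe_lt_coe.1 h⟩
    by_contra h0
    obtain rfl : k = 0 := by omega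
    simp at h

section Stationary

variable {Ω : Type u} {B : Type v} [NormedAddCommGroup B] {𝓕₀ : MeasurableSpace Ω}
  [mΩ : MeasurableSpace Ω] {T : Ω ≃ᵐ Ω} {m : Ω → B} {μ : Measure Ω}

lemma condSq_nonneg : 0 ≤ᵐ[μ] condSq 𝓕₀ T m μ :=
  condExp_nonneg (ae_of_all _ fun ω => by positivity)

lemma setLIntegral_condSq [IsFiniteMeasure μ] (hle : imageSigma 𝓕₀ T.toEquiv ≤ mΩ)
    (hint : Integrable (fun ω => ‖m ω‖ ^ 2) μ) {A : Set Ω}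
    (hA : MeasurableSet[imageSigma 𝓕₀ T.toEquiv] A) :
    ∫⁻ ω in A, ENNReal.ofReal (condSq 𝓕₀ T m μ ω) ∂μ = ∫⁻ ω in A, ‖m ω‖ₑ ^ (2 : ℝ) ∂μ := by
  have h := setIntegral_condExp hle hint hA
  have h1 := congrArg ENNReal.ofReal h
  rw [ofReal_integral_eq_lintegral_ofReal integrable_condExp.integrableOn
      (ae_restrict_of_ae (condSq_nonneg (𝓕₀ := 𝓕₀) (T := T) (m := m))),
    ofReal_integral_eq_lintegral_ofReal hint.integrableOn
      (ae_of_all _ fun ω => by positivity)] at h1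
  refine Eq.trans h1 ?_
  congr 1
  ext ω
  rw [← ofReal_norm, ENNReal.ofReal_rpow_of_nonneg (norm_nonneg _) two_pos.le, Real.rpow_two]

/-- A maximal-type bound for averages along the orbits: only the excess of `Y` over `t` can bring
the average over `2 * t`. -/
lemma measure_two_mul_lt_sum_iterate_le (hT : MeasurePreserving T μ μ) {Y : Ω → ℝ}
    (hY : Measurable Y) {t : ℝ} (ht : 0 < t) {N : ℕ} (hN : 0 < N) :
    μ {ω | ENNReal.ofReal (2 * N * t) < ∑ i ∈ Finset.range N, ENNReal.ofReal (Y (T^[i + 1] ω))} ≤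
      (ENNReal.ofReal t)⁻¹ * ∫⁻ ω, (ENNReal.ofReal (Y ω) - ENNReal.ofReal t) ∂μ := by
  set g : Ω → ℝ≥0∞ := fun ω => ENNReal.ofReal (Y ω) - ENNReal.ofReal t with hg
  have hgm : Measurable g := hY.ennreal_ofReal.sub_const _
  have hTi : ∀ i : ℕ, MeasurePreserving (T^[i]) μ μ := fun i => hT.iterate i
  have ht0 : ENNReal.ofReal t ≠ 0 := (ENNReal.ofReal_pos.2 ht).ne'
  have hN0 : (N : ℝ≥0∞) ≠ 0 := by exact_mod_cast hN.ne'
  have hc : (N : ℝ≥0∞) * ENNReal.ofReal t ≠ ∞ := by finiteness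
  have hint : ∫⁻ ω, ∑ i ∈ Finset.range N, g (T^[i + 1] ω) ∂μ = N * ∫⁻ ω, g ω ∂μ := by
    rw [lintegral_finsetSum (f := fun i ω => g (T^[i + 1] ω)) _
      fun i _ => hgm.comp (hTi (i + 1)).measurable]
    simp_rw [(hTi _).lintegral_comp hgm]
    simp
  have hsub : {ω | ENNReal.ofReal (2 * N * t) <
      ∑ i ∈ Finset.range N, ENNReal.ofReal (Y (T^[i + 1] ω))} ⊆
      {ω | N * ENNReal.ofReal t ≤ ∑ i ∈ Finset.range N, g (T^[i + 1] ω)} := by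
    intro ω hω
    rw [Set.mem_ofPred_eq] at hω ⊢
    have h1 : ∑ i ∈ Finset.range N, ENNReal.ofReal (Y (T^[i + 1] ω)) ≤
        ∑ i ∈ Finset.range N, g (T^[i + 1] ω) + N * ENNReal.ofReal t := by
      calc _ ≤ ∑ i ∈ Finset.range N, (g (T^[i + 1] ω) + ENNReal.ofReal t) :=
            Finset.sum_le_sum fun i _ => le_tsub_add
        _ = _ := by rw [Finset.sum_add_distrib]; simp
    have h2 : ENNReal.ofReal (2 * N * t) = N * ENNReal.ofReal t + N * ENNReal.ofReal t := by
      rw [← two_mul, mul_assoc, ENNReal.ofReal_mul two_pos.le, ENNReal.ofReal_mul (by positivity),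
        ENNReal.ofReal_natCast, ENNReal.ofReal_ofNat]
    rw [h2] at hω
    exact ((ENNReal.add_le_add_iff_right hc).1 (hω.le.trans h1))
  refine (measure_mono hsub).trans ?_
  refine (meas_ge_le_lintegral_div (Finset.measurable_fun_sum
    (f := fun i ω => g (T^[i + 1] ω)) _ fun i _ => hgm.comp (hTi (i + 1)).measurable).aemeasurable (mul_ne_zero hN0 ht0) hc).trans (le_of_eq ?_)
  rw [hint, ENNReal.mul_div_mul_left _ _ hN0 (by finiteness), ENNReal.div_eq_inv_mul]

lemma weightedDeviation_le [IsProbabilityMeasure μ] (T : Ω → Ω) (s x : ℝ) (n : ℕ) :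
    weightedDeviation T m μ s x n ≤ ENNReal.ofReal ((2 : ℝ) ^ ((n : ℝ) * s / 2)) := by
  rw [weightedDeviation]
  exact (mul_le_mul_right prob_le_one _).trans (mul_one _).le

variable [NormedSpace ℝ B] [CompleteSpace B]

lemma IsStationaryMartingaleDifference.le (h : IsStationaryMartingaleDifference 𝓕₀ T m μ) :
    𝓕₀ ≤ mΩ := by
  have := h.martingaleDifference.le 0
  rwa [Function.iterate_zero, MeasurableSpace.comap_id] at this

lemma IsStationaryMartingaleDifference.stronglyMeasurable
    (h : IsStationaryMartingaleDifference 𝓕₀ T m μ) : StronglyMeasurable m :=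
  (h.martingaleDifference.adapted 0).mono (h.martingaleDifference.le 0)

lemma IsStationaryMartingaleDifference.measurable_condSq
    (h : IsStationaryMartingaleDifference 𝓕₀ T m μ) : Measurable (condSq 𝓕₀ T m μ) :=
  (stronglyMeasurable_condExp.mono (h.image_le.trans h.le)).measurable

/-- The good-λ inequality for a stationary sequence: the conditional second moments are those of
`m`, carried along the orbits. -/
lemma IsStationaryMartingaleDifference.measure_lt_maxPartialSum_le [IsProbabilityMeasure μ]
    {D : ℝ≥0}
    (hB : IsRDSmooth.{u, v} B 2 D) (h : IsStationaryMartingaleDifference 𝓕₀ T m μ)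
    (hint : Integrable (fun ω => ‖m ω‖ ^ 2) μ) (N : ℕ) {l δ : ℝ} (hl : 0 < l)
    (hδ2 : δ ≤ 1 / 2) :
    μ {ω | 2 * l < (maxPartialSum T m N ω : ℝ)} ≤
      ENNReal.ofReal (4 * D * δ ^ 2) * μ {ω | l < (maxPartialSum T m N ω : ℝ)} +
      N * μ {ω | δ * l < ‖m ω‖} +
      μ {ω | ENNReal.ofReal ((δ * l) ^ 2) <
        ∑ i ∈ Finset.range N, ENNReal.ofReal (condSq 𝓕₀ T m μ (T^[i + 1] ω))} := by
  have hTi : ∀ i : ℕ, MeasurePreserving (T^[i]) μ μ := fun i => h.measurePreserving.iterate i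
  have hT1 : ∀ i : ℕ, T.symm ∘ T^[i + 1] = T^[i] := fun i => by
    ext ω; rw [Function.comp_apply, Function.iterate_succ_apply', T.symm_apply_apply]
  have hcomap : ∀ i : ℕ, (imageSigma 𝓕₀ T.toEquiv).comap (T^[i + 1]) = 𝓕₀.comap (T^[i]) :=
    fun i => by
      rw [imageSigma, MeasurableSpace.comap_comp, ← hT1 i]
      rfl
  have hle := h.image_le.trans h.le
  have key := h.martingaleDifference.measure_lt_norm_sum_le hB
    (v := fun i ω => ENNReal.ofReal (condSq 𝓕₀ T m μ (T^[i + 1] ω))) (fun i => ?_)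
    (fun i E hE => ?_) N hl hδ2
  · have hm : ∀ i : ℕ, μ {ω | δ * l < ‖(m ∘ T^[i]) ω‖} = μ {ω | δ * l < ‖m ω‖} := fun i =>
      (hTi i).measure_preimage (measurableSet_lt measurable_const
        h.stronglyMeasurable.norm.measurable).nullMeasurableSet
    simp only [hm, Finset.sum_const, Finset.card_range, nsmul_eq_mul] at key
    simp only [lt_maxPartialSum_iff T m N _ hl,
      lt_maxPartialSum_iff T m N _ (show 0 < 2 * l by positivity)]
    exact key
  · have h1 : Measurable[imageSigma 𝓕₀ T.toEquiv]
        fun ω => ENNReal.ofReal (condSq 𝓕₀ T m μ ω) :=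
      ENNReal.measurable_ofReal.comp stronglyMeasurable_condExp.measurable
    have h2 : Measurable[𝓕₀.comap (T^[i]), imageSigma 𝓕₀ T.toEquiv] (T^[i + 1]) := by
      rw [← hcomap i]; exact comap_measurable _
    exact h1.comp h2
  · -- an event of `𝓕₀.comap T^[i]` is the preimage under `T^[i + 1]` of one of `T 𝓕₀`
    rw [← hcomap i] at hE
    obtain ⟨A, hA, rfl⟩ := hE
    have h3 : Measurable fun ω => ‖m ω‖ₑ ^ (2 : ℝ) :=
      h.stronglyMeasurable.enorm.pow_const _
    rw [(hTi (i + 1)).setLIntegral_comp_preimage (hle _ hA)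
        h.measurable_condSq.ennreal_ofReal, setLIntegral_condSq hle hint hA]
    exact ((hTi (i + 1)).setLIntegral_comp_preimage (hle _ hA) h3).le

/-- The recursion in `x` at a fixed scale `n`: the weight `2 ^ (n * s / 2)` turns both error terms
of the good-λ inequality into dyadic tails at level `n`, respectively above `n`. -/
lemma IsStationaryMartingaleDifference.weightedDeviation_two_mul_le [IsProbabilityMeasure μ]
    {D : ℝ≥0}
    (hB : IsRDSmooth.{u, v} B 2 D) (h : IsStationaryMartingaleDifference 𝓕₀ T m μ)
    (hint : Integrable (fun ω => ‖m ω‖ ^ 2) μ) {s δ : ℝ} (hδ : 0 < δ) (hδ2 : δ ≤ 1 / 2)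
    (hδs : 4 * D * δ ^ 2 ≤ 2 ^ (-s - 1)) (n : ℕ) {x : ℝ} (hx : 0 < x) :
    weightedDeviation T m μ s (2 * x) n ≤
      ENNReal.ofReal (2 ^ (-s - 1)) * weightedDeviation T m μ s x n +
      (dyadicTail (s / 2 + 1) m μ (δ * x) n +
        ∑' k, ENNReal.ofReal ((2 : ℝ) ^ (1 - s / 2)) ^ k *
          dyadicTail (s / 2) (condSq 𝓕₀ T m μ) μ ((δ * x) ^ 2 / 2) (n + k)) := by
  have hw : (2 : ℝ) ^ ((n : ℝ) * s / 2) = ((2 : ℝ) ^ n) ^ (s / 2) := by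
    rw [← Real.rpow_natCast, ← Real.rpow_mul two_pos.le, mul_div_assoc]
  have hz : 0 < (δ * x) ^ 2 / 2 := by positivity
  have h1 := h.measure_lt_maxPartialSum_le hB hint (2 ^ n) (l := 2 ^ n * x) (by positivity) hδ2
  have h2 := measure_two_mul_lt_sum_iterate_le (N := 2 ^ n) h.measurePreserving
    h.measurable_condSq (t := 2 ^ n * ((δ * x) ^ 2 / 2)) (by positivity) (by positivity)
  have h3 := lintegral_excess_le (p := s / 2) (μ := μ)
    h.measurable_condSq.aestronglyMeasurable hz n
  have h4 : 2 * ((2 ^ n : ℕ) : ℝ) * (2 ^ n * ((δ * x) ^ 2 / 2)) = (δ * (2 ^ n * x)) ^ 2 := by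
    push_cast; ring
  rw [h4] at h2
  rw [weightedDeviation, weightedDeviation, hw, mul_left_comm ((2 : ℝ) ^ n) 2 x]
  refine (mul_le_mul_right (h1.trans (add_le_add_right h2 _)) _).trans ?_
  rw [mul_add, mul_add, add_assoc]
  refine add_le_add ?_ (add_le_add (le_of_eq ?_) h3)
  · rw [mul_left_comm]
    gcongr
  · rw [dyadicTail, Real.rpow_add (by positivity), Real.rpow_one, ENNReal.ofReal_mul (by positivity),
      mul_assoc, mul_left_comm δ]
    norm_cast

end Stationary

/-! ### The bound in terms of the moments -/

/-- A factor bounding the remainder of the recursion in terms of `momentBound`. It collects the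
geometric sums over the dyadic levels and the rescaling of the thresholds, `δ * x` for `‖m‖` and
`(δ * x) ^ 2 / 2` for the conditional second moment, back to `x`. -/
noncomputable def remainderConst (s δ : ℝ) : ℝ≥0∞ :=
  ENNReal.ofReal ((2 : ℝ) ^ (s / 2 + 1) / (2 ^ (s / 2 + 1) - 1)) *
      ENNReal.ofReal (δ ^ (-(s / 2 + 1))) +
    (1 - ENNReal.ofReal ((2 : ℝ) ^ (1 - s / 2)))⁻¹ *
      (ENNReal.ofReal ((2 : ℝ) ^ (s / 2) / (2 ^ (s / 2) - 1)) *
        ENNReal.ofReal ((δ ^ 2 / 2) ^ (-(s / 2))))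

/-- The right-hand side `b * x ^ (-s / 2 - 1) + v * x ^ (-s)` of the deviation bounds. -/
noncomputable def momentBound (s : ℝ) (b v : ℝ≥0∞) (x : ℝ) : ℝ≥0∞ :=
  b * ENNReal.ofReal (x ^ (-(s / 2) - 1)) + v * ENNReal.ofReal (x ^ (-s))

lemma ofReal_two_rpow_lt_one {s : ℝ} (hs : 2 < s) : ENNReal.ofReal ((2 : ℝ) ^ (1 - s / 2)) < 1 := by
  rw [ENNReal.ofReal_lt_one]
  exact Real.rpow_lt_one_of_one_lt_of_neg one_lt_two (by linarith)

lemma remainderConst_ne_top {s : ℝ} (hs : 2 < s) (δ : ℝ) : remainderConst s δ ≠ ∞ := by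
  have : (1 - ENNReal.ofReal ((2 : ℝ) ^ (1 - s / 2)))⁻¹ ≠ ∞ :=
    ENNReal.inv_ne_top.2 (tsub_pos_of_lt (ofReal_two_rpow_lt_one hs)).ne'
  rw [remainderConst]
  finiteness

lemma one_le_ofReal_two_rpow_div {p : ℝ} (hp : 0 < p) :
    1 ≤ ENNReal.ofReal ((2 : ℝ) ^ p / (2 ^ p - 1)) := by
  have : (1 : ℝ) < 2 ^ p := Real.one_lt_rpow one_lt_two hp
  rw [ENNReal.one_le_ofReal, one_le_div (by linarith)]
  linarith

lemma momentBound_halving {s : ℝ} (hs : 2 < s) (c b v : ℝ≥0∞) {x : ℝ} (hx : 0 < x) :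
    c * momentBound s b v (x / 2) ≤ ENNReal.ofReal (2 ^ s) * (c * momentBound s b v x) := by
  have h : ∀ a : ℝ, -s ≤ a →
      ENNReal.ofReal ((x / 2) ^ a) ≤ ENNReal.ofReal (2 ^ s) * ENNReal.ofReal (x ^ a) := by
    intro a ha
    rw [← ENNReal.ofReal_mul (by positivity), Real.div_rpow hx.le two_pos.le, div_eq_inv_mul,
      ← Real.rpow_neg two_pos.le]
    gcongr
    · exact one_le_two
    · linarith
  rw [mul_left_comm]
  gcongr
  rw [momentBound, momentBound, mul_add, mul_left_comm, mul_left_comm _ v]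
  gcongr
  · exact h _ (by linarith)
  · exact h _ le_rfl

/-- The remainder terms of the recursion, once summed over the dyadic levels, are dominated by
`momentBound`. -/
lemma remainder_le_momentBound {s δ x : ℝ} (hδ : 0 < δ) (hx : 0 < x) (b v : ℝ≥0∞) :
    ENNReal.ofReal ((2 : ℝ) ^ (s / 2 + 1) / (2 ^ (s / 2 + 1) - 1)) *
        (ENNReal.ofReal ((δ * x) ^ (-(s / 2 + 1))) * b) +
      (1 - ENNReal.ofReal ((2 : ℝ) ^ (1 - s / 2)))⁻¹ *
        (ENNReal.ofReal ((2 : ℝ) ^ (s / 2) / (2 ^ (s / 2) - 1)) *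
          (ENNReal.ofReal (((δ * x) ^ 2 / 2) ^ (-(s / 2))) * v)) ≤
      remainderConst s δ * momentBound s b v x := by
  have h1 : ENNReal.ofReal ((δ * x) ^ (-(s / 2 + 1))) =
      ENNReal.ofReal (δ ^ (-(s / 2 + 1))) * ENNReal.ofReal (x ^ (-(s / 2) - 1)) := by
    rw [Real.mul_rpow hδ.le hx.le, ENNReal.ofReal_mul (by positivity), neg_add']
  have h2 : ENNReal.ofReal (((δ * x) ^ 2 / 2) ^ (-(s / 2))) =
      ENNReal.ofReal ((δ ^ 2 / 2) ^ (-(s / 2))) * ENNReal.ofReal (x ^ (-s)) := by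
    rw [show (δ * x) ^ 2 / 2 = δ ^ 2 / 2 * x ^ 2 by ring,
      Real.mul_rpow (by positivity) (by positivity), ENNReal.ofReal_mul (by positivity),
      ← Real.rpow_natCast x 2, ← Real.rpow_mul hx.le]
    congr 3
    push_cast; ring
  rw [h1, h2, remainderConst, momentBound, add_mul]
  refine add_le_add ?_ ?_
  · refine le_trans (le_of_eq ?_) (mul_le_mul_right le_self_add _)
    ring
  · refine le_trans (le_of_eq ?_) (mul_le_mul_right le_add_self _)
    ring

/-- A threshold `δ` making the factor `4 * D * δ ^ 2` of the good-λ inequality small. -/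
lemma exists_threshold (D : ℝ≥0) (s : ℝ) (hs : 2 < s) :
    ∃ δ : ℝ, 0 < δ ∧ δ ≤ 1 / 2 ∧ 4 * D * δ ^ 2 ≤ 2 ^ (-s - 1) := by
  set e : ℝ := 2 ^ (-s - 1) with he
  have he0 : 0 < e := by positivity
  have he1 : e ≤ 1 := Real.rpow_le_one_of_one_le_of_nonpos one_le_two (by linarith)
  have hD : (0 : ℝ) ≤ D := D.2
  have h1 : e / (2 * (D + 1)) ≤ 1 / 2 := by
    rw [div_le_div_iff₀ (by positivity) two_pos]; linarith
  refine ⟨e / (2 * (D + 1)), by positivity, h1, ?_⟩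
  calc 4 * D * (e / (2 * (D + 1))) ^ 2
      = 4 * D * (e / (2 * (D + 1))) * (e / (2 * (D + 1))) := by ring
    _ ≤ 4 * D * (e / (2 * (D + 1))) * (1 / 2) := by gcongr
    _ = e * (D / (D + 1)) := by field_simp; ring
    _ ≤ e * 1 := by gcongr; rw [div_le_one (by positivity)]; linarith
    _ = e := mul_one e

section Bounds

variable {Ω : Type u} {B : Type v} [NormedAddCommGroup B] [NormedSpace ℝ B] [CompleteSpace B]
  {𝓕₀ : MeasurableSpace Ω} [mΩ : MeasurableSpace Ω] {T : Ω ≃ᵐ Ω} {m : Ω → B} {μ : Measure Ω}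
  [IsProbabilityMeasure μ] {D : ℝ≥0} {s δ : ℝ}

lemma ofReal_two_rpow_neg_lt_one (hs : 2 < s) : ENNReal.ofReal ((2 : ℝ) ^ (-s - 1)) < 1 := by
  rw [ENNReal.ofReal_lt_one]
  exact Real.rpow_lt_one_of_one_lt_of_neg one_lt_two (by linarith)

lemma IsStationaryMartingaleDifference.weightedDeviation_le_weakMoment
    (hB : IsRDSmooth.{u, v} B 2 D) (h : IsStationaryMartingaleDifference 𝓕₀ T m μ)
    (hs : 2 < s) (hδ : 0 < δ) (hδ2 : δ ≤ 1 / 2) (hδs : 4 * D * δ ^ 2 ≤ 2 ^ (-s - 1))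
    (hint : Integrable (fun ω => ‖m ω‖ ^ 2) μ) {x : ℝ} (hx : 0 < x) (n : ℕ) :
    weightedDeviation T m μ s x n ≤ ENNReal.ofReal (2 ^ (s + 1)) * (remainderConst s δ *
      momentBound s (weakMoment (s / 2 + 1) m μ) (weakMoment (s / 2) (condSq 𝓕₀ T m μ) μ) x) := by
  refine le_of_halving (f := fun x => weightedDeviation T m μ s x n)
    (φ := fun x => remainderConst s δ * momentBound s _ _ x)
    (fun x hx => momentBound_halving hs _ _ _ hx)
    (fun x hx => ?_) (fun x _ => tendsto_pow_mul_of_le_const (ofReal_two_rpow_neg_lt_one hs)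
      ENNReal.ofReal_ne_top (fun x => weightedDeviation_le T s x n) x) hx
  refine (h.weightedDeviation_two_mul_le hB hint hδ hδ2 hδs n hx).trans (add_le_add_right ?_ _)
  refine le_trans (add_le_add ?_ ?_) (remainder_le_momentBound hδ hx _ _)
  · exact (dyadicTail_le_weakMoment (by positivity) n).trans
      (le_mul_of_one_le_left zero_le (one_le_ofReal_two_rpow_div (by linarith)))
  · refine tsum_geometric_mul_shift_le n fun k => ?_
    exact (dyadicTail_le_weakMoment (by positivity) _).trans
      (le_mul_of_one_le_left zero_le (one_le_ofReal_two_rpow_div (by linarith)))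

lemma IsStationaryMartingaleDifference.tsum_weightedDeviation_le
    (hB : IsRDSmooth.{u, v} B 2 D) (h : IsStationaryMartingaleDifference 𝓕₀ T m μ)
    (hs : 2 < s) (hδ : 0 < δ) (hδ2 : δ ≤ 1 / 2) (hδs : 4 * D * δ ^ 2 ≤ 2 ^ (-s - 1))
    (hint : Integrable (fun ω => ‖m ω‖ ^ 2) μ) {x : ℝ} (hx : 0 < x) :
    ∑' n : ℕ, weightedDeviation T m μ s x (n + 1) ≤
      ENNReal.ofReal (2 ^ (s + 1)) * (remainderConst s δ *
        momentBound s (∫⁻ ω, ‖m ω‖ₑ ^ (s / 2 + 1) ∂μ)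
          (∫⁻ ω, ‖condSq 𝓕₀ T m μ ω‖ₑ ^ (s / 2) ∂μ) x) := by
  -- partial sums, unlike the series, are known to be bounded, so that the recursion can be iterated
  refine ENNReal.tsum_le_of_sum_range_le fun N => ?_
  refine le_of_halving (f := fun x => ∑ n ∈ Finset.range N, weightedDeviation T m μ s x (n + 1))
    (φ := fun x => remainderConst s δ * momentBound s _ _ x)
    (fun x hx => momentBound_halving hs _ _ _ hx)
    (fun x hx => ?_) (fun x _ => tendsto_pow_mul_of_le_const (ofReal_two_rpow_neg_lt_one hs)
      (ENNReal.sum_ne_top.2 fun n _ => ENNReal.ofReal_ne_top)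
      (fun x => Finset.sum_le_sum fun n _ => weightedDeviation_le T s x (n + 1)) x) hx
  have hshift : ∀ g : ℕ → ℝ≥0∞, ∑ n ∈ Finset.range N, g (n + 1) ≤ ∑' n, g n := fun g =>
    (ENNReal.sum_le_tsum _).trans
      (ENNReal.tsum_comp_le_tsum_of_injective (add_left_injective 1) g)
  refine (Finset.sum_le_sum fun n _ =>
    h.weightedDeviation_two_mul_le hB hint hδ hδ2 hδs (n + 1) hx).trans ?_
  rw [Finset.sum_add_distrib, ← Finset.mul_sum, Finset.sum_add_distrib]
  refine add_le_add_right (le_trans (add_le_add ?_ ?_) (remainder_le_momentBound hδ hx _ _)) _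
  · exact (hshift _).trans (tsum_dyadicTail_le (by linarith)
      h.stronglyMeasurable.aestronglyMeasurable (by positivity))
  · refine (hshift fun n => ∑' k, _ ^ k * dyadicTail (s / 2) _ μ _ (n + k)).trans
      (tsum_tsum_geometric_mul_shift_le.trans ?_)
    gcongr
    exact tsum_dyadicTail_le (by linarith) h.measurable_condSq.aestronglyMeasurable (by positivity)

lemma IsStationaryMartingaleDifference.tendsto_weightedDeviation
    (hB : IsRDSmooth.{u, v} B 2 D) (h : IsStationaryMartingaleDifference 𝓕₀ T m μ)
    (hs : 2 < s) (hδ : 0 < δ) (hδ2 : δ ≤ 1 / 2) (hδs : 4 * D * δ ^ 2 ≤ 2 ^ (-s - 1))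
    (hm : MemWeakLpZero (s / 2 + 1) m μ) (hV : MemWeakLpZero (s / 2) (condSq 𝓕₀ T m μ) μ)
    {x : ℝ} (hx : 0 < x) :
    Tendsto (fun n : ℕ => weightedDeviation T m μ s x n) atTop (𝓝 0) := by
  have hm' := hm.memWeakLp (by linarith)
  have hV' := hV.memWeakLp (by linarith)
  have hint := hm'.integrable_norm_sq (by linarith)
  set φ : ℝ → ℝ≥0∞ := fun x => ENNReal.ofReal (2 ^ (s + 1)) * remainderConst s δ * momentBound s
    (weakMoment (s / 2 + 1) m μ) (weakMoment (s / 2) (condSq 𝓕₀ T m μ) μ) x with hφ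
  have hφtop : ∀ x, φ x ≠ ∞ := by
    intro x
    have h1 := remainderConst_ne_top hs δ
    have h2 := hm'.2
    have h3 := hV'.2
    simp only [hφ, momentBound]
    finiteness
  have hφ2 : ∀ x, 0 < x → φ (x / 2) ≤ ENNReal.ofReal (2 ^ s) * φ x := fun x hx =>
    momentBound_halving hs _ _ _ hx
  -- the upper limit satisfies the recursion without a remainder
  have hlim : ∀ x, 0 < x → limsup (fun n => weightedDeviation T m μ s (2 * x) n) atTop ≤
      ENNReal.ofReal (2 ^ (-s - 1)) * limsup (fun n => weightedDeviation T m μ s x n) atTop := by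
    intro x hx
    refine (limsup_le_limsup (Eventually.of_forall fun n =>
      h.weightedDeviation_two_mul_le hB hint hδ hδ2 hδs n hx)).trans
      (limsup_mul_add_le ENNReal.ofReal_ne_top ?_)
    have := (tendsto_dyadicTail hm (y := δ * x) (by positivity)).add
      (tendsto_tsum_geometric_mul_shift (ofReal_two_rpow_lt_one hs)
        (tendsto_dyadicTail hV (y := (δ * x) ^ 2 / 2) (by positivity)))
    rwa [add_zero] at this
  have hbound : ∀ x, 0 < x → limsup (fun n => weightedDeviation T m μ s x n) atTop ≤ φ x := by
    intro x hx
    refine limsup_le_of_le (h := Eventually.of_forall fun n => ?_)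
    rw [hφ]
    dsimp only
    rw [mul_assoc]
    exact h.weightedDeviation_le_weakMoment hB hs hδ hδ2 hδs hint hx n
  have h0 := le_of_halving (φ := 0) (s := s)
    (f := fun x => limsup (fun n => weightedDeviation T m μ s x n) atTop) (fun _ _ => by simp)
    (fun x hx => by simpa using hlim x hx)
    (fun x hx => tendsto_pow_mul_of_halving hφ2 hx (hφtop x) hbound) hx
  simp only [Pi.zero_apply, mul_zero] at h0
  exact tendsto_of_le_liminf_of_limsup_le zero_le h0

end Bounds

theorem theorem6 {B : Type v} [NormedAddCommGroup B] [NormedSpace ℝ B] [CompleteSpace B]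
    [TopologicalSpace.SeparableSpace B] (D : ℝ≥0) (hB : IsRDSmooth.{u, v} B 2 D)
    (s : ℝ) (hs : 2 < s) :
    ∃ C : ℝ≥0, ∀ (Ω : Type u) (𝓕₀ : MeasurableSpace Ω) [mΩ : MeasurableSpace Ω]
      (μ : Measure Ω) [IsProbabilityMeasure μ] (T : Ω ≃ᵐ Ω) (m : Ω → B),
      IsStationaryMartingaleDifference 𝓕₀ T m μ →
      (MemWeakLp (s / 2 + 1) m μ → MemWeakLp (s / 2) (condSq 𝓕₀ T m μ) μ →
        ∀ x : ℝ, 0 < x →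
          (⨆ (n : ℕ) (_ : 1 ≤ n), weightedDeviation T m μ s x n) ≤
            C * (weakMoment (s / 2 + 1) m μ * ENNReal.ofReal (x ^ (-(s / 2) - 1)) +
              weakMoment (s / 2) (condSq 𝓕₀ T m μ) μ * ENNReal.ofReal (x ^ (-s)))) ∧
      (MemWeakLpZero (s / 2 + 1) m μ → MemWeakLpZero (s / 2) (condSq 𝓕₀ T m μ) μ →
        ∀ x : ℝ, 0 < x →
          Tendsto (fun n : ℕ => weightedDeviation T m μ s x n) atTop (𝓝 0)) ∧
      (MemLp m (ENNReal.ofReal (s / 2 + 1)) μ →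
        MemLp (condSq 𝓕₀ T m μ) (ENNReal.ofReal (s / 2)) μ →
        ∀ x : ℝ, 0 < x →
          (∑' n : ℕ, weightedDeviation T m μ s x (n + 1)) ≤
            C * (ENNReal.ofReal (x ^ (-(s / 2) - 1)) * ∫⁻ ω, ‖m ω‖ₑ ^ (s / 2 + 1) ∂μ +
              ENNReal.ofReal (x ^ (-s)) * ∫⁻ ω, ‖condSq 𝓕₀ T m μ ω‖ₑ ^ (s / 2) ∂μ)) := by
  obtain ⟨δ, hδ, hδ2, hδs⟩ := exists_threshold D s hs
  have hC : ENNReal.ofReal (2 ^ (s + 1)) * remainderConst s δ ≠ ∞ :=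
    ENNReal.mul_ne_top ENNReal.ofReal_ne_top (remainderConst_ne_top hs δ)
  refine ⟨(ENNReal.ofReal (2 ^ (s + 1)) * remainderConst s δ).toNNReal, ?_⟩
  intro Ω 𝓕₀ mΩ μ _ T m h
  rw [ENNReal.coe_toNNReal hC]
  refine ⟨fun hm _ x hx => iSup₂_le fun n _ => ?_, fun hm hV x hx => ?_, fun hm _ x hx => ?_⟩
  · rw [mul_assoc]
    exact h.weightedDeviation_le_weakMoment hB hs hδ hδ2 hδs
      (hm.integrable_norm_sq (by linarith)) hx n
  · exact h.tendsto_weightedDeviation hB hs hδ hδ2 hδs hm hV hx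
  · have hint : Integrable (fun ω => ‖m ω‖ ^ 2) μ := by
      have h2 : MemLp m 2 μ := hm.mono_exponent (by
        rw [← ENNReal.ofReal_ofNat]
        exact ENNReal.ofReal_le_ofReal (by linarith))
      exact h2.integrable_norm_pow two_ne_zero
    rw [mul_assoc, mul_comm (ENNReal.ofReal (x ^ (-(s / 2) - 1))),
      mul_comm (ENNReal.ofReal (x ^ (-s)))]
    exact h.tsum_weightedDeviation_le hB hs hδ hδ2 hδs hint hx
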